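/- Setting. Let $H=\sum_{\ell=1}^{L}h_\ell H_\ell$ on $\mathbb{C}^d$ with $h_\ell\ge 0$ and $H_\ell$ Hermitian of operator norm $\|H_\ell\|=1$; let $t\in\mathbb{R}$ and let $N$ be a positive integer. Put $\lambda=\sum_\ell h_\ell$, $p_\ell=h_\ell/\lambda$, $\tau=\lambda t/N$. Let $\mathcal{U}(\rho)=e^{iHt}\rho e^{-iHt}$ be the ideal channel, $\mathcal{E}_N(\rho)=\sum_\ell p_\ell\, e^{iH_\ell\tau}\rho e^{-iH_\ell\tau}$ the qDRIFT channel, $\mathcal{L}(\rho)=\frac{i}{\lambda}[H,\rho]$, $\mathcal{L}_\ell(\rho)=i[H_\ell,\rho]$ and $\mathcal{L}^{(n)}=\mathcal{L}^n-\sum_\ell p_\ell\mathcal{L}_\ell^n$. For superoperators $\vec{\mathcal{A}}=(\mathcal{A}_1,\dots,\mathcal{A}_k)$ and $\mathcal{B}$, let $M_{k,N-k}(\vec{\mathcal{A}},\mathcal{B})$ be the mixture function: the sum of the $\binom{N}{k}$ products of $\mathcal{A}_1,\dots,\mathcal{A}_k$ and $N-k$ copies of $\mathcal{B}$ in which $\mathcal{A}_1,\dots,\mathcal{A}_k$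 occur in this order. For $1\le K\le N$, the $K$-th order qSWIFT channel is the truncation at total $\tau$-degree $2K-2$ of the expansion of $\mathcal{U}=(\mathcal{E}_N+\Delta_2)^N$, where $\Delta_2=\sum_{n\ge2}\frac{\tau^n}{n!}\mathcal{L}^{(n)}$ (with $\mathcal{E}_N$ itself not expanded in $\tau$): $$\Phi^{(K)}=\mathcal{E}_N^N+\sum_{\xi=2}^{2K-2}\tau^\xi\sum_{k=1}^N\ \sum_{\substack{2\le n_1,\dots,n_k\le\xi\\ n_1+\cdots+n_k=\xi}}\frac{1}{n_1!\cdots n_k!}\,M_{k,N-k}\big((\mathcal{L}^{(n_1)},\dots,\mathcal{L}^{(n_k)}),\mathcal{E}_N\big).$$ Let $d_\diamond(\Phi,\Psi)=\frac12\|\Phi-\Psi\|_\diamond$ be the diamond distance, and let $\eta(x,N)=\frac12\big(1+\frac{1}{2ex}\big)\frac{1}{1-(2ex)^2/N}$. Lemma. Let $K\ge1$. (a) There is a constant $C_K$, depending only on $K$, such that for all data as above with $N\ge K$ and $\lambda t\ge1$, $$d_\diamond(\mathcal{U},\Phi^{(K)})\le C_K\left(\frac{(\lambda t)^2}{N}\right)^K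 .$$ (b) If $N\ge K$, $\lambda t>0$ and $(2e\lambda t)^2/N<1$, then $$d_\diamond(\mathcal{U},\Phi^{(K)})\le\eta(\lambda t,N)\left(\frac{(2e\lambda t)^2}{N}\right)^K .$$ (c) If $N\ge K$ and $1\le\lambda t\le\sqrt{N}/(2\sqrt2\,e)$, then $\eta(\lambda t,N)\le\frac32$, and hence $d_\diamond(\mathcal{U},\Phi^{(K)})\le\frac32\left(\frac{(2e\lambda t)^2}{N}\right)^K$. -/

import Mathlib

noncomputable section

namespace QSwift

/-- Linear maps on the complex `d × d` matrices (superoperators). Multiplication is composition. -/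
abbrev SuperOp (d : ℕ) : Type :=
  Module.End ℂ (Matrix (Fin d) (Fin d) ℂ)

/-! ### Trace norm, diamond norm, diamond distance -/

/-- The trace norm `Tr √(X† X)`: the sum of the singular values of `X`, that is, of the square
roots of the eigenvalues (with multiplicity) of `X† X`. -/
def traceNorm {ι : Type} [Fintype ι] [DecidableEq ι] (X : Matrix ι ι ℂ) : ℝ :=
  ∑ i, Real.sqrt ((Matrix.isHermitian_conjTranspose_mul_self X).eigenvalues i)

/-- `Φ ⊗ id` with an ancilla of dimension `n`: `Φ` is applied to each of the `n × n` blocks, i.e.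
`(Φ ⊗ id) (A ⊗ B) = Φ A ⊗ B`. -/
def ampliate {d : ℕ} (Φ : SuperOp d) (n : ℕ)
    (X : Matrix (Fin d × Fin n) (Fin d × Fin n) ℂ) :
    Matrix (Fin d × Fin n) (Fin d × Fin n) ℂ :=
  Matrix.of fun x y => Φ (Matrix.of fun i j => X (i, x.2) (j, y.2)) x.1 y.1

/-- The diamond norm: the supremum, over all ancilla dimensions `n`, of the operator norm of
`Φ ⊗ id_n` induced by the trace norm. It takes values in `[0, ∞]`, so that the supremum is never
a default value. -/
def diamondNorm {d : ℕ} (Φ : SuperOp d) : ENNReal :=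
  ⨆ (n : ℕ) (X : Matrix (Fin d × Fin n) (Fin d × Fin n) ℂ) (_ : traceNorm X ≤ 1),
    ENNReal.ofReal (traceNorm (ampliate Φ n X))

/-- The diamond distance `½ ‖Φ - Ψ‖_⋄`. -/
def diamondDist {d : ℕ} (Φ Ψ : SuperOp d) : ENNReal :=
  diamondNorm (Φ - Ψ) / 2

/-! ### Sorting and mixture functions -/

/-- The permutations in `S_{k+m}` which keep the relative order of the first `k` indices and the
relative order of the last `m` indices (there are `(k+m).choose k` of them). -/
def shuffles (k m : ℕ) : Finset (Equiv.Perm (Fin (k + m))) :=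
  {σ | (∀ i j : Fin k, i < j → σ (Fin.castAdd m i) < σ (Fin.castAdd m j)) ∧
       (∀ i j : Fin m, i < j → σ (Fin.natAdd k i) < σ (Fin.natAdd k j))}

/-- The product of the sequence `X = (A₁, …, A_k, B₁, …, B_m)`, sorted so that `X_j` is the factor
at position `σ j`. -/
def sorting {R : Type} [Semiring R] {k m : ℕ} (σ : Equiv.Perm (Fin (k + m)))
    (A : Fin k → R) (B : Fin m → R) : R :=
  (List.ofFn fun p => Fin.append A B (σ.symm p)).prod

/-- The mixture function `M_{k,m}(A, B)`. -/
def mixture {R : Type} [Semiring R] {k m : ℕ} (A : Fin k → R) (B : Fin m → R) : R :=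
  ∑ σ ∈ shuffles k m, sorting σ A B

/-! ### Hamiltonian evolution, qDRIFT and qSWIFT -/

/-- The evolution `ρ ↦ e^{iAs} ρ e^{-iAs}` (for Hermitian `A`, `e^{-iAs}` is the adjoint of
`e^{iAs}`). -/
def evolution {d : ℕ} (A : Matrix (Fin d) (Fin d) ℂ) (s : ℝ) : SuperOp d :=
  LinearMap.mulLeft ℂ (NormedSpace.exp ((Complex.I * (s : ℂ)) • A)) ∘ₗ
    LinearMap.mulRight ℂ (NormedSpace.exp (-((Complex.I * (s : ℂ)) • A)))

/-- The superoperator `ρ ↦ i [A, ρ]`. -/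
def commOp {d : ℕ} (A : Matrix (Fin d) (Fin d) ℂ) : SuperOp d :=
  Complex.I • (LinearMap.mulLeft ℂ A - LinearMap.mulRight ℂ A)

variable {d L : ℕ} (h : Fin L → ℝ) (H : Fin L → Matrix (Fin d) (Fin d) ℂ) (t : ℝ) (N : ℕ)

/-- `λ = ∑ h_ℓ`. -/
def lam : ℝ := ∑ l, h l

/-- `p_ℓ = h_ℓ / λ`. -/
def prob (l : Fin L) : ℝ := h l / lam h

/-- `τ = λ t / N`. -/
def tau : ℝ := lam h * t / N

/-- `H = ∑ h_ℓ H_ℓ`. -/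
def ham : Matrix (Fin d) (Fin d) ℂ := ∑ l, (h l : ℂ) • H l

/-- The ideal channel `ρ ↦ e^{iHt} ρ e^{-iHt}`. -/
def idealU : SuperOp d := evolution (ham h H) t

/-- The qDRIFT channel `E_N = ∑ p_ℓ T_ℓ` with `T_ℓ ρ = e^{iH_ℓ τ} ρ e^{-iH_ℓ τ}`. -/
def qdrift : SuperOp d := ∑ l, (prob h l : ℂ) • evolution (H l) (tau h t N)

/-- `ℒ ρ = (i / λ) [H, ρ]`. -/
def lOp : SuperOp d := ((lam h)⁻¹ : ℂ) • commOp (ham h H)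

/-- `ℒ^{(n)} = ℒ^n - ∑ p_ℓ ℒ_ℓ^n` with `ℒ_ℓ ρ = i [H_ℓ, ρ]`. -/
def lDiff (n : ℕ) : SuperOp d := lOp h H ^ n - ∑ l, (prob h l : ℂ) • commOp (H l) ^ n

/-- The coefficient of `τ^ξ` in the mixture-function expansion of `(E_N + Δ₂)^N - E_N^N`, with
`Δ₂ = ∑_{n ≥ 2} τ^n / n! ℒ^{(n)}`: the sum over `1 ≤ k ≤ N` and over the integers
`2 ≤ n₁, …, n_k ≤ ξ` with `n₁ + ⋯ + n_k = ξ` of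
`1 / (n₁! ⋯ n_k!) • M_{k,N-k}((ℒ^{(n₁)}, …, ℒ^{(n_k)}), E_N)`. -/
def qswiftCoeff (ξ : ℕ) : SuperOp d :=
  ∑ k ∈ Finset.Icc 1 N, ∑ n ∈ Fintype.piFinset (fun _ : Fin k => Finset.Icc 2 ξ),
    if ξ = ∑ j, n j then
      (∏ j, ((n j).factorial : ℂ))⁻¹ •
        mixture (fun j => lDiff h H (n j)) (fun _ : Fin (N - k) => qdrift h H t N)
    else 0

/-- The `K`-th order qSWIFT channel
`Φ^{(K)} = E_N^N + ∑_{ξ=2}^{2K-2} τ^ξ • (coefficient of τ^ξ)`. -/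
def qswift (K : ℕ) : SuperOp d :=
  qdrift h H t N ^ N +
    ∑ ξ ∈ Finset.Icc 2 (2 * K - 2), ((tau h t N : ℂ) ^ ξ) • qswiftCoeff h H t N ξ

/-- `η(x, N) = ½ (1 + 1 / (2 e x)) · 1 / (1 - (2 e x)² / N)`. -/
def eta (x : ℝ) (N : ℕ) : ℝ :=
  1 / 2 * (1 + 1 / (2 * Real.exp 1 * x)) * (1 / (1 - (2 * Real.exp 1 * x) ^ 2 / N))

end QSwift

end

/-!
Put `x = λ t`, `τ = x / N`, `y = 2 e x`. Each `exp (i H_ℓ τ)` acts by `exp (τ ℒ_ℓ)`, so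
`𝒰 = (exp (τ ℒ))^N = (E_N + Δ₂)^N` with `Δ₂ = exp (τ ℒ) - E_N = ∑_{n ≥ 2} τ^n / n! ℒ^{(n)}`; the
terms `n = 0, 1` vanish because the `p_ℓ` sum to `1` and `ℒ = ∑ p_ℓ ℒ_ℓ`. Expanding the power in
mixture functions (`sum_smul_add_pow`) and collecting by the total degree `ξ` in `τ`, the channel
`Φ^{(K)}` is the part of degree at most `2K - 2`, and the error is the tail `ξ ≥ 2K - 1`.

The diamond norm is subadditive and submultiplicative, at most `1` on `E_N` and at most `2^{n+1}` on
`ℒ^{(n)}`. A mixture function with `k` slots has `N.choose k ≤ N^k / k!` terms, and `k ≤ ξ / 2`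
since every `n_j ≥ 2`. As `∑_{n ≥ 2} 1 / n! ≤ 1`, the coefficient of `τ^ξ` is at most
`2^ξ N^{⌊ξ/2⌋} ∑_k 2^k / k! ≤ 2^ξ N^{⌊ξ/2⌋} e² ≤ (2e)^ξ N^{⌊ξ/2⌋}`
(`diamondBounded_mixtureCoeff`). With `r = y² / N` the degree `ξ` therefore contributes at most
`r^j` if `ξ = 2j` and `r^j / y` if `ξ = 2j - 1`, and the tail is at most the geometric sum
`(1 + 1/y) r^K / (1 - r) = 2 η r^K` (`sum_degreeBound_le`). The asymptotic bound follows from this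
when `r ≤ 1/2`; otherwise `2r ≥ 1`, and it follows from separate bounds for `𝒰` and
for each degree of `Φ^{(K)}` (`diamondDist_le_of_half_le`).

The infinite series for `Δ₂` is replaced by its partial sums, and the bound passes to the limit
(`DiamondBounded.of_tendsto`, `tendsto_idealU`). The properties of the diamond norm rest on the
duality `‖X‖₁ = sup {|Tr (W X)| : ‖W‖ ≤ 1}` (`traceNorm_le_iff`), proved from a singular value
decomposition.
-/

noncomputable section

namespace QSwift

/-! ### The trace norm -/

section TraceNorm

open scoped Matrix.Norms.L2Operator ComplexOrder

variable {ι : Type} [Fintype ι] [DecidableEq ι]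

/-- A singular value decomposition `X V = Y diag(σ)`, with `V` unitary and `Y` a contraction: `V`
diagonalizes `X† X`, and `Y = X V diag(σ)⁻¹`. -/
theorem exists_singularValueDecomposition (X : Matrix ι ι ℂ) :
    ∃ V Y : Matrix ι ι ℂ, ∃ σ : ι → ℝ, V * star V = 1 ∧ star V * V = 1 ∧ ‖Y‖ ≤ 1 ∧
      (∀ i, 0 ≤ σ i) ∧ traceNorm X = ∑ i, σ i ∧
      X * V = Y * Matrix.diagonal (fun i => (σ i : ℂ)) ∧
      star Y * (X * V) = Matrix.diagonal (fun i => (σ i : ℂ)) := by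
  set hX := Matrix.isHermitian_conjTranspose_mul_self X
  set V : Matrix ι ι ℂ := (hX.eigenvectorUnitary : Matrix ι ι ℂ)
  set σ : ι → ℝ := fun i => Real.sqrt (hX.eigenvalues i)
  have hV1 : V * star V = 1 := Unitary.coe_mul_star_self _
  have hV2 : star V * V = 1 := Unitary.coe_star_mul_self _
  have hσ : ∀ i, σ i * σ i = hX.eigenvalues i := fun i =>
    Real.mul_self_sqrt ((Matrix.posSemidef_conjTranspose_mul_self X).eigenvalues_nonneg i)
  have hdiag : star (X * V) * (X * V) = Matrix.diagonal (fun i => ((σ i * σ i : ℝ) : ℂ)) := by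
    have := hX.conjStarAlgAut_star_eigenvectorUnitary
    rw [Unitary.conjStarAlgAut_star_apply] at this
    simp only [hσ]
    rw [star_mul]
    calc _ = star V * (Matrix.conjTranspose X * X) * V := by
            simp only [Matrix.star_eq_conjTranspose, mul_assoc]
      _ = _ := this
  -- the pseudo-inverse of `diag(σ)`: here `0⁻¹ = 0` is what is wanted
  set P : Matrix ι ι ℂ := Matrix.diagonal fun i => (((σ i)⁻¹ : ℝ) : ℂ) with hP
  have hPs : star P = P := by
    rw [hP, Matrix.star_eq_conjTranspose, Matrix.diagonal_conjTranspose]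
    congr 1; ext i; simp
  have hYX : star (X * V * P) * (X * V) = Matrix.diagonal (fun i => (σ i : ℂ)) := by
    rw [star_mul, hPs, mul_assoc, hdiag, hP, Matrix.diagonal_mul_diagonal]
    congr 1; ext i
    rcases eq_or_ne (σ i) 0 with h | h
    · simp [h]
    · push_cast; rw [inv_mul_cancel_left₀ (by exact_mod_cast h)]
  -- the columns of `X V` which belong to the singular value `0` vanish
  have hker : X * V * (1 - P * Matrix.diagonal (fun i => (σ i : ℂ))) = 0 := by
    rw [← Matrix.conjTranspose_mul_self_eq_zero, ← Matrix.star_eq_conjTranspose, star_mul,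
      mul_assoc, ← mul_assoc (star (X * V)), hdiag, hP, Matrix.diagonal_mul_diagonal,
      ← Matrix.diagonal_one, Matrix.diagonal_sub, Matrix.diagonal_mul_diagonal,
      Matrix.star_eq_conjTranspose, Matrix.diagonal_conjTranspose, Matrix.diagonal_mul_diagonal,
      ← Matrix.diagonal_zero]
    congr 1; ext i
    rcases eq_or_ne (σ i) 0 with h | h
    · simp [h]
    · have : (σ i : ℂ) ≠ 0 := by exact_mod_cast h
      simp [this]
  refine ⟨V, X * V * P, σ, hV1, hV2, ?_, fun i => Real.sqrt_nonneg _, rfl, ?_, hYX⟩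
  · have h1 : ‖X * V * P‖ * ‖X * V * P‖ ≤ 1 := by
      rw [← CStarRing.norm_star_mul_self, ← mul_assoc, hYX, hP, Matrix.diagonal_mul_diagonal,
        Matrix.l2_opNorm_diagonal]
      refine (pi_norm_le_iff_of_nonneg zero_le_one).2 fun i => ?_
      rcases eq_or_ne (σ i) 0 with h | h
      · simp [h]
      · have : (σ i : ℂ) ≠ 0 := by exact_mod_cast h
        simp [this]
    nlinarith [norm_nonneg (X * V * P)]
  · rw [mul_sub, mul_one, sub_eq_zero] at hker
    rw [mul_assoc (X * V)]; exact hker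

theorem norm_entry_le (A : Matrix ι ι ℂ) (i j : ι) : ‖A i j‖ ≤ ‖A‖ := by
  have h := Matrix.l2_opNorm_mulVec A (EuclideanSpace.single j (1 : ℂ))
  have h2 := PiLp.norm_apply_le
    ((EuclideanSpace.equiv ι ℂ).symm (A.mulVec (EuclideanSpace.single j (1 : ℂ)).ofLp)) i
  simp at h h2
  exact h2.trans h

theorem traceNorm_nonneg (X : Matrix ι ι ℂ) : 0 ≤ traceNorm X :=
  Finset.sum_nonneg fun _ _ => Real.sqrt_nonneg _

theorem norm_star_mul_mul_le {V A : Matrix ι ι ℂ} (h : V * star V = 1) (h' : star V * V = 1) :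
    ‖star V * A * V‖ ≤ ‖A‖ := by
  let U : unitary (Matrix ι ι ℂ) := ⟨V, h', h⟩
  have h1 : ‖star V * A * V‖ = ‖star V * A‖ := CStarRing.norm_mul_coe_unitary (star V * A) U
  have h2 : ‖star V * A‖ = ‖A‖ := CStarRing.norm_coe_unitary_mul (star U) A
  rw [h1, h2]

theorem norm_trace_mul_le (W X : Matrix ι ι ℂ) : ‖(W * X).trace‖ ≤ ‖W‖ * traceNorm X := by
  obtain ⟨V, Y, σ, hV, hV', hY, hσ, hX, hXV, -⟩ := exists_singularValueDecomposition X
  have h1 : (W * X).trace =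
      ((star V * (W * Y * star V) * V) * Matrix.diagonal fun i => (σ i : ℂ)).trace := by
    rw [mul_assoc (star V), mul_assoc _ (star V), hV', mul_one, mul_assoc (star V),
      mul_assoc W, ← hXV, ← mul_assoc W, ← mul_assoc, Matrix.trace_mul_cycle, hV, one_mul]
  have h2 : ‖star V * (W * Y * star V) * V‖ ≤ ‖W‖ := by
    have hVn : ‖W * Y * star V‖ = ‖W * Y‖ :=
      CStarRing.norm_mul_coe_unitary (W * Y) (star (⟨V, hV', hV⟩ : unitary (Matrix ι ι ℂ)))
    refine (norm_star_mul_mul_le hV hV').trans ?_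
    rw [hVn]
    refine (norm_mul_le _ _).trans ?_
    nlinarith [norm_nonneg W]
  rw [h1, hX, Matrix.trace, Finset.mul_sum]
  refine (norm_sum_le _ _).trans (Finset.sum_le_sum fun i _ => ?_)
  rw [Matrix.diag_apply, Matrix.mul_diagonal, norm_mul, Complex.norm_real, Real.norm_eq_abs,
    abs_of_nonneg (hσ i)]
  exact mul_le_mul_of_nonneg_right ((norm_entry_le _ i i).trans h2) (hσ i)

/-- Duality between the trace norm and the operator norm: `‖X‖₁` is the supremum of `|Tr (W X)|`
over the contractions `W`. -/
theorem traceNorm_le_iff {X : Matrix ι ι ℂ} {c : ℝ} :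
    traceNorm X ≤ c ↔ ∀ W : Matrix ι ι ℂ, ‖W‖ ≤ 1 → ‖(W * X).trace‖ ≤ c := by
  constructor
  · intro h W hW
    refine (norm_trace_mul_le W X).trans (le_trans ?_ h)
    nlinarith [traceNorm_nonneg X]
  · intro h
    obtain ⟨V, Y, σ, hV, hV', hY, hσ, hX, -, hYX⟩ := exists_singularValueDecomposition X
    -- the supremum is attained at `W = V Y†`
    have h1 : ‖V * star Y‖ ≤ 1 := by
      have : ‖V * star Y‖ = ‖star Y‖ :=
        CStarRing.norm_coe_unitary_mul (⟨V, hV', hV⟩ : unitary (Matrix ι ι ℂ)) _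
      rwa [this, norm_star]
    have h2 := h _ h1
    rw [mul_assoc, Matrix.trace_mul_comm, mul_assoc, hYX,
      Matrix.trace_diagonal, ← Complex.ofReal_sum, Complex.norm_real, ← hX, Real.norm_eq_abs,
      abs_of_nonneg (traceNorm_nonneg X)] at h2
    exact h2

theorem traceNorm_add_le (X Y : Matrix ι ι ℂ) : traceNorm (X + Y) ≤ traceNorm X + traceNorm Y := by
  refine traceNorm_le_iff.2 fun W hW => ?_
  rw [mul_add, Matrix.trace_add]
  exact (norm_add_le _ _).trans
    (add_le_add (traceNorm_le_iff.1 le_rfl W hW) (traceNorm_le_iff.1 le_rfl W hW))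

theorem traceNorm_smul_le (c : ℂ) (X : Matrix ι ι ℂ) : traceNorm (c • X) ≤ ‖c‖ * traceNorm X := by
  refine traceNorm_le_iff.2 fun W hW => ?_
  rw [mul_smul_comm, Matrix.trace_smul, norm_smul]
  exact mul_le_mul_of_nonneg_left (traceNorm_le_iff.1 le_rfl W hW) (norm_nonneg c)

theorem traceNorm_zero : traceNorm (0 : Matrix ι ι ℂ) = 0 := by
  simpa using (traceNorm_smul_le 0 (0 : Matrix ι ι ℂ)).antisymm (by simpa using traceNorm_nonneg _)

theorem traceNorm_mul_mul_le (A X B : Matrix ι ι ℂ) :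
    traceNorm (A * X * B) ≤ ‖A‖ * ‖B‖ * traceNorm X := by
  refine traceNorm_le_iff.2 fun W hW => ?_
  rw [← mul_assoc, Matrix.trace_mul_cycle, ← mul_assoc]
  refine (norm_trace_mul_le _ X).trans (mul_le_mul_of_nonneg_right ?_ (traceNorm_nonneg X))
  calc ‖B * W * A‖ ≤ ‖B‖ * ‖W‖ * ‖A‖ :=
        (norm_mul_le _ _).trans (mul_le_mul_of_nonneg_right (norm_mul_le _ _) (norm_nonneg _))
    _ ≤ ‖B‖ * 1 * ‖A‖ := by gcongr
    _ = ‖A‖ * ‖B‖ := by ring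

end TraceNorm

/-! ### Expansion of a power of a sum in mixture functions -/

theorem append_const {R : Type} {k m : ℕ} (D B : R) (q : Fin (k + m)) :
    Fin.append (fun _ : Fin k => D) (fun _ : Fin m => B) q = if q.val < k then D else B := by
  refine Fin.addCases (fun i => ?_) (fun i => ?_) q
  · simp
  · simp

/-- The positions which a permutation of `Fin (k + m)` assigns to the first `k` indices. -/
def firstPositions {k m : ℕ} (σ : Equiv.Perm (Fin (k + m))) : Finset (Fin (k + m)) :=
  Finset.univ.filter fun p => (σ.symm p).val < k

theorem firstPositions_eq_map {k m : ℕ} (σ : Equiv.Perm (Fin (k + m))) :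
    firstPositions σ =
      Finset.univ.map ((Fin.castAddEmb m).trans σ.toEmbedding) := by
  ext p
  simp only [firstPositions, Finset.mem_filter, Finset.mem_univ, true_and, Finset.mem_map]
  constructor
  · intro h
    exact ⟨⟨_, h⟩, by simp⟩
  · rintro ⟨i, rfl⟩
    simp

theorem card_firstPositions {k m : ℕ} (σ : Equiv.Perm (Fin (k + m))) :
    (firstPositions σ).card = k := by
  simp [firstPositions_eq_map]

theorem card_compl_firstPositions {k m : ℕ} (σ : Equiv.Perm (Fin (k + m))) :
    (firstPositions σ)ᶜ.card = m := by
  rw [Finset.card_compl, card_firstPositions, Fintype.card_fin]; omega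

/-- A shuffle is determined by its first positions, since it enumerates them and their complement
in increasing order. -/
theorem shuffle_eq {k m : ℕ} {σ : Equiv.Perm (Fin (k + m))} (hσ : σ ∈ shuffles k m) :
    σ = finSumFinEquiv.symm.trans
      (finSumEquivOfFinset (card_firstPositions σ) (card_compl_firstPositions σ)) := by
  simp only [shuffles, Finset.mem_filter, Finset.mem_univ, true_and] at hσ
  have h1 := Finset.orderEmbOfFin_unique (card_firstPositions σ)
    (f := fun i => σ (Fin.castAdd m i)) (fun i => by simp [firstPositions])
    (fun i j hij => hσ.1 i j hij)
  have h2 := Finset.orderEmbOfFin_unique (card_compl_firstPositions σ)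
    (f := fun i => σ (Fin.natAdd k i)) (fun i => by simp [firstPositions])
    (fun i j hij => hσ.2 i j hij)
  ext q
  refine Fin.addCases (fun i => ?_) (fun i => ?_) q
  · simp [finSumEquivOfFinset_inl, ← h1]
  · simp [finSumEquivOfFinset_inr, ← h2]

theorem firstPositions_injOn (k m : ℕ) :
    Set.InjOn (firstPositions (k := k) (m := m)) (shuffles k m : Set (Equiv.Perm _)) := by
  intro σ hσ σ' hσ' h
  rw [shuffle_eq hσ, shuffle_eq hσ']
  congr 2

theorem exists_shuffle {k m : ℕ} (S : Finset (Fin (k + m))) (hS : S.card = k) :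
    ∃ σ ∈ shuffles k m, firstPositions σ = S := by
  have hS' : Sᶜ.card = m := by rw [Finset.card_compl, hS, Fintype.card_fin]; omega
  refine ⟨finSumFinEquiv.symm.trans (finSumEquivOfFinset hS hS'), ?_, ?_⟩
  · simp [shuffles]
  · refine Finset.eq_of_subset_of_card_le (fun p hp => ?_) (by rw [hS, card_firstPositions])
    rw [firstPositions_eq_map] at hp
    obtain ⟨i, -, rfl⟩ := Finset.mem_map.1 hp
    simp

theorem sum_shuffles {M : Type} [AddCommMonoid M] (k m : ℕ) (f : Finset (Fin (k + m)) → M) :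
    ∑ σ ∈ shuffles k m, f (firstPositions σ) =
      ∑ S ∈ Finset.powersetCard k (Finset.univ : Finset (Fin (k + m))), f S := by
  refine Finset.sum_nbij firstPositions (fun σ _ => ?_) (firstPositions_injOn k m) ?_
    (fun _ _ => rfl)
  · simp [Finset.mem_powersetCard, card_firstPositions]
  · intro S hS
    obtain ⟨σ, h, h'⟩ := exists_shuffle S (Finset.mem_powersetCard.1 hS).2
    exact ⟨σ, h, h'⟩

theorem card_shuffles (k m : ℕ) : (shuffles k m).card = (k + m).choose k := by
  have := sum_shuffles k m (fun _ => (1 : ℕ))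
  simpa using this

/-- The noncommutative binomial expansion: a product of `N` factors `D + B` is the sum, over the
sets of positions at which `D` is chosen, of the resulting words, and the sets of size `k` make up
the mixture function `M_{k,N-k}`. -/
theorem add_pow_eq_sum_mixture {R : Type} [Ring R] (B D : R) (N : ℕ) :
    (D + B) ^ N = ∑ k ∈ Finset.range (N + 1), mixture (fun _ : Fin k => D)
      (fun _ : Fin (N - k) => B) := by
  have h := (MultilinearMap.mkPiAlgebraFin ℤ N R).map_add_univ (fun _ => D) (fun _ => B)
  have h0 : ((fun _ => D) + fun _ => B : Fin N → R) = fun _ => D + B := rfl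
  rw [h0, MultilinearMap.mkPiAlgebraFin_apply_const] at h
  rw [h, ← Finset.powerset_univ, Finset.sum_powerset]
  simp only [Finset.card_univ, Fintype.card_fin]
  refine Finset.sum_congr rfl fun k hk => ?_
  obtain ⟨m, rfl⟩ := Nat.exists_eq_add_of_le (Nat.lt_succ_iff.1 (Finset.mem_range.1 hk))
  rw [Nat.add_sub_cancel_left, mixture, ← sum_shuffles]
  refine Finset.sum_congr rfl fun σ _ => ?_
  rw [sorting, MultilinearMap.mkPiAlgebraFin_apply]
  congr 2
  ext p
  rw [append_const, Finset.piecewise]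
  simp [firstPositions]


theorem append_update_symm {R : Type} {k m : ℕ} (σ : Equiv.Perm (Fin (k + m))) (A : Fin k → R)
    (B : Fin m → R) (i : Fin k) (z : R) :
    (fun p => Fin.append (Function.update A i z) B (σ.symm p)) =
      Function.update (fun p => Fin.append A B (σ.symm p)) (σ (Fin.castAdd m i)) z := by
  ext p
  obtain ⟨q, rfl⟩ := σ.surjective p
  simp only [Function.update_apply, Equiv.symm_apply_apply, σ.injective.eq_iff]
  refine Fin.addCases (fun j => ?_) (fun j => ?_) q
  · simp [Function.update_apply]
  · have : Fin.natAdd k j ≠ Fin.castAdd m i := fun h => by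
      have := congrArg Fin.val h
      simp at this; omega
    simp [this]

/-- The sorted product as a multilinear map in its first `k` factors. -/
def sortingMultilinear {R : Type} [Ring R] [Algebra ℂ R] {k m : ℕ} (σ : Equiv.Perm (Fin (k + m)))
    (B : Fin m → R) : MultilinearMap ℂ (fun _ : Fin k => R) R where
  toFun A := MultilinearMap.mkPiAlgebraFin ℂ (k + m) R fun p => Fin.append A B (σ.symm p)
  map_update_add' {dec} A i x y := by
    obtain rfl : dec = instDecidableEqFin k := Subsingleton.elim _ _
    simp only [append_update_symm, MultilinearMap.map_update_add]
  map_update_smul' {dec} A i c x := by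
    obtain rfl : dec = instDecidableEqFin k := Subsingleton.elim _ _
    simp only [append_update_symm, MultilinearMap.map_update_smul]

theorem sortingMultilinear_apply {R : Type} [Ring R] [Algebra ℂ R] {k m : ℕ}
    (σ : Equiv.Perm (Fin (k + m))) (A : Fin k → R) (B : Fin m → R) :
    sortingMultilinear σ B A = sorting σ A B := rfl

theorem mixture_sum_smul {R : Type} [Ring R] [Algebra ℂ R] {k m : ℕ} (S : Finset ℕ) (c : ℕ → ℂ)
    (a : ℕ → R) (B : Fin m → R) :
    mixture (fun _ : Fin k => ∑ n ∈ S, c n • a n) B =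
      ∑ n ∈ Fintype.piFinset (fun _ : Fin k => S),
        (∏ j, c (n j)) • mixture (fun j => a (n j)) B := by
  simp only [mixture, Finset.smul_sum]
  rw [Finset.sum_comm]
  refine Finset.sum_congr rfl fun σ _ => ?_
  rw [← sortingMultilinear_apply, MultilinearMap.map_sum_finset]
  refine Finset.sum_congr rfl fun n _ => ?_
  rw [MultilinearMap.map_smul_univ, sortingMultilinear_apply]

/-- The expansion of `(B + ∑_{n ∈ S} c_n a_n)^N` in mixture functions. -/
theorem sum_smul_add_pow {R : Type} [Ring R] [Algebra ℂ R] (S : Finset ℕ) (c : ℕ → ℂ)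
    (a : ℕ → R) (B : R) (N : ℕ) :
    (∑ n ∈ S, c n • a n + B) ^ N = B ^ N + ∑ k ∈ Finset.Icc 1 N,
      ∑ n ∈ Fintype.piFinset (fun _ : Fin k => S),
        (∏ j, c (n j)) • mixture (fun j => a (n j)) (fun _ : Fin (N - k) => B) := by
  rw [add_pow_eq_sum_mixture, Finset.sum_range_succ', add_comm]
  congr 1
  · have h : ∀ q : Fin (0 + (N - 0)), Fin.append (fun _ : Fin 0 => ∑ n ∈ S, c n • a n)
        (fun _ : Fin (N - 0) => B) q = B := fun q => by rw [append_const]; simp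
    simp only [mixture, sorting, h, Finset.sum_const, card_shuffles]
    simp
  · rw [Finset.range_eq_Ico, Finset.sum_Ico_add' (fun k => mixture (fun _ : Fin k =>
      ∑ n ∈ S, c n • a n) (fun _ : Fin (N - k) => B)) 0 N 1]
    refine Finset.sum_congr rfl fun k _ => ?_
    rw [mixture_sum_smul]

/-! ### Bounds for the diamond norm -/

section Diamond

open scoped Matrix.Norms.L2Operator Kronecker

variable {d : ℕ}

/-- `Φ ⊗ id` at a fixed argument, as a linear function of `Φ`. -/
def ampliateLinear (n : ℕ) (X : Matrix (Fin d × Fin n) (Fin d × Fin n) ℂ) :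
    SuperOp d →ₗ[ℂ] Matrix (Fin d × Fin n) (Fin d × Fin n) ℂ where
  toFun Φ := ampliate Φ n X
  map_add' _ _ := rfl
  map_smul' _ _ := rfl

theorem ampliateLinear_apply (n : ℕ) (X : Matrix (Fin d × Fin n) (Fin d × Fin n) ℂ)
    (Φ : SuperOp d) : ampliateLinear n X Φ = ampliate Φ n X := rfl

theorem ampliate_mulLeft (A : Matrix (Fin d) (Fin d) ℂ) (n : ℕ)
    (X : Matrix (Fin d × Fin n) (Fin d × Fin n) ℂ) :
    ampliate (LinearMap.mulLeft ℂ A) n X = (A ⊗ₖ (1 : Matrix (Fin n) (Fin n) ℂ)) * X := by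
  ext x y
  simp [ampliate, Matrix.mul_apply, Fintype.sum_prod_type, Matrix.one_apply]

theorem ampliate_mulRight (A : Matrix (Fin d) (Fin d) ℂ) (n : ℕ)
    (X : Matrix (Fin d × Fin n) (Fin d × Fin n) ℂ) :
    ampliate (LinearMap.mulRight ℂ A) n X = X * (A ⊗ₖ (1 : Matrix (Fin n) (Fin n) ℂ)) := by
  ext x y
  simp [ampliate, Matrix.mul_apply, Fintype.sum_prod_type, Matrix.one_apply]

theorem norm_kronecker_one_le (A : Matrix (Fin d) (Fin d) ℂ) (n : ℕ) :
    ‖A ⊗ₖ (1 : Matrix (Fin n) (Fin n) ℂ)‖ ≤ ‖A‖ := by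
  -- `A ↦ A ⊗ 1` is a `*`-homomorphism of C*-algebras, hence a contraction
  let φ : Matrix (Fin d) (Fin d) ℂ →⋆ₙₐ[ℂ] Matrix (Fin d × Fin n) (Fin d × Fin n) ℂ :=
    { toFun := fun A => A ⊗ₖ (1 : Matrix (Fin n) (Fin n) ℂ)
      map_smul' := fun c A => Matrix.smul_kronecker c A 1
      map_zero' := Matrix.zero_kronecker _
      map_add' := fun A B => Matrix.add_kronecker A B 1
      map_mul' := fun A B => by rw [← Matrix.mul_kronecker_mul, one_mul]
      map_star' := fun A => by
        simp only [Matrix.star_eq_conjTranspose, Matrix.conjTranspose_kronecker,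
          Matrix.conjTranspose_one] }
  exact NonUnitalStarAlgHom.norm_apply_le φ A

/-- The diamond norm of `Φ` is at most `c`: every ampliation `Φ ⊗ id` is bounded by `c` in the
trace norm. -/
def DiamondBounded (Φ : SuperOp d) (c : ℝ) : Prop :=
  ∀ (n : ℕ) (X : Matrix (Fin d × Fin n) (Fin d × Fin n) ℂ),
    traceNorm (ampliate Φ n X) ≤ c * traceNorm X

namespace DiamondBounded

variable {Φ Ψ : SuperOp d} {a b : ℝ}

theorem mono (h : DiamondBounded Φ a) (hab : a ≤ b) : DiamondBounded Φ b := fun n X =>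
  (h n X).trans (mul_le_mul_of_nonneg_right hab (traceNorm_nonneg X))

theorem zero : DiamondBounded (0 : SuperOp d) 0 := fun n X => by
  rw [← ampliateLinear_apply, map_zero, traceNorm_zero, zero_mul]

theorem one : DiamondBounded (1 : SuperOp d) 1 := fun n X => by
  have : ampliate (1 : SuperOp d) n X = X := rfl
  rw [this, one_mul]

theorem add (h : DiamondBounded Φ a) (h' : DiamondBounded Ψ b) : DiamondBounded (Φ + Ψ) (a + b) :=
  fun n X => by
    rw [← ampliateLinear_apply, map_add, add_mul]
    exact (traceNorm_add_le _ _).trans (add_le_add (h n X) (h' n X))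

theorem smul (c : ℂ) (h : DiamondBounded Φ a) : DiamondBounded (c • Φ) (‖c‖ * a) := fun n X => by
  rw [← ampliateLinear_apply, map_smul, mul_assoc]
  exact (traceNorm_smul_le _ _).trans (mul_le_mul_of_nonneg_left (h n X) (norm_nonneg c))

theorem sub (h : DiamondBounded Φ a) (h' : DiamondBounded Ψ b) :
    DiamondBounded (Φ - Ψ) (a + b) := by
  rw [sub_eq_add_neg, ← neg_one_smul ℂ Ψ]
  exact (h.add (h'.smul (-1))).mono (by simp)

theorem sum {κ : Type} (s : Finset κ) {F : κ → SuperOp d} {c : κ → ℝ}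
    (h : ∀ i ∈ s, DiamondBounded (F i) (c i)) : DiamondBounded (∑ i ∈ s, F i) (∑ i ∈ s, c i) := by
  classical
  induction s using Finset.induction_on with
  | empty => simpa using zero
  | insert i s hi ih =>
    rw [Finset.sum_insert hi, Finset.sum_insert hi]
    exact (h i (Finset.mem_insert_self i s)).add
      (ih fun j hj => h j (Finset.mem_insert_of_mem hj))

theorem mul (h : DiamondBounded Φ a) (h' : DiamondBounded Ψ b) (ha : 0 ≤ a) :
    DiamondBounded (Φ * Ψ) (a * b) := fun n X => by
  have : ampliate (Φ * Ψ) n X = ampliate Φ n (ampliate Ψ n X) := rfl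
  rw [this, mul_assoc]
  exact (h n _).trans (mul_le_mul_of_nonneg_left (h' n X) ha)

theorem pow (h : DiamondBounded Φ a) (ha : 0 ≤ a) (n : ℕ) : DiamondBounded (Φ ^ n) (a ^ n) := by
  induction n with
  | zero => simpa using one
  | succ n ih => rw [pow_succ, pow_succ]; exact ih.mul h (pow_nonneg ha n)

theorem prod_ofFn {n : ℕ} {F : Fin n → SuperOp d} {c : Fin n → ℝ} (hc : ∀ i, 0 ≤ c i)
    (h : ∀ i, DiamondBounded (F i) (c i)) :
    DiamondBounded (List.ofFn F).prod (∏ i, c i) := by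
  induction n with
  | zero => simpa using one
  | succ n ih =>
    rw [List.ofFn_succ, List.prod_cons, Fin.prod_univ_succ]
    exact (h 0).mul (ih (fun i => hc i.succ) fun i => h i.succ) (hc 0)

/-- A mixture function of `k` superoperators and `m` copies of a contraction consists of
`(k + m).choose k` products. -/
theorem mixture {k m : ℕ} {A : Fin k → SuperOp d} {B : SuperOp d} {c : Fin k → ℝ}
    (hc : ∀ i, 0 ≤ c i) (hA : ∀ i, DiamondBounded (A i) (c i)) (hB : DiamondBounded B 1) :
    DiamondBounded (mixture A fun _ : Fin m => B) ((k + m).choose k * ∏ i, c i) := by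
  have key : ∀ σ ∈ shuffles k m, DiamondBounded (sorting σ A fun _ : Fin m => B) (∏ i, c i) := by
    intro σ _
    have h := prod_ofFn (F := fun p => Fin.append A (fun _ : Fin m => B) (σ.symm p))
      (c := fun p => Fin.append c (fun _ : Fin m => 1) (σ.symm p))
      (fun p => by
        refine Fin.addCases (fun i => ?_) (fun i => ?_) (σ.symm p)
        · simpa using hc i
        · simp)
      (fun p => by
        refine Fin.addCases (fun i => ?_) (fun i => ?_) (σ.symm p)
        · simpa using hA i
        · simpa using hB)
    have h' : ∏ p, Fin.append c (fun _ : Fin m => (1 : ℝ)) (σ.symm p) = ∏ i, c i := by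
      rw [Equiv.prod_comp σ.symm (Fin.append c fun _ : Fin m => (1 : ℝ)), Fin.prod_univ_add]
      simp
    rwa [h'] at h
  have h := sum (shuffles k m) key
  rwa [Finset.sum_const, card_shuffles, nsmul_eq_mul] at h

theorem diamondNorm_le (h : DiamondBounded Φ a) (ha : 0 ≤ a) :
    diamondNorm Φ ≤ ENNReal.ofReal a := by
  refine iSup_le fun n => iSup_le fun X => iSup_le fun hX => ENNReal.ofReal_le_ofReal ?_
  exact (h n X).trans (by nlinarith)

theorem diamondDist_le (h : DiamondBounded (Φ - Ψ) (2 * a)) (ha : 0 ≤ a) :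
    diamondDist Φ Ψ ≤ ENNReal.ofReal a := by
  refine (ENNReal.div_le_div_right (h.diamondNorm_le (by positivity)) 2).trans_eq ?_
  rw [ENNReal.ofReal_mul zero_le_two, ENNReal.ofReal_ofNat, mul_comm,
    ENNReal.mul_div_cancel_right (by norm_num) (by norm_num)]

theorem mulLeft_comp_mulRight (A B : Matrix (Fin d) (Fin d) ℂ) :
    DiamondBounded (LinearMap.mulLeft ℂ A ∘ₗ LinearMap.mulRight ℂ B) (‖A‖ * ‖B‖) := fun n X => by
  have : ampliate (LinearMap.mulLeft ℂ A ∘ₗ LinearMap.mulRight ℂ B) n X =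
      (A ⊗ₖ 1) * X * (B ⊗ₖ (1 : Matrix (Fin n) (Fin n) ℂ)) := by
    rw [mul_assoc, ← ampliate_mulRight, ← ampliate_mulLeft]; rfl
  rw [this]
  refine (traceNorm_mul_mul_le _ _ _).trans
    (mul_le_mul_of_nonneg_right ?_ (traceNorm_nonneg X))
  exact mul_le_mul (norm_kronecker_one_le A n) (norm_kronecker_one_le B n) (norm_nonneg _)
    (norm_nonneg _)

theorem norm_one_le : ‖(1 : Matrix (Fin d) (Fin d) ℂ)‖ ≤ 1 := by
  rw [← Matrix.diagonal_one, Matrix.l2_opNorm_diagonal]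
  exact (pi_norm_le_iff_of_nonneg zero_le_one).2 fun i => by simp

theorem commOp (A : Matrix (Fin d) (Fin d) ℂ) : DiamondBounded (commOp A) (2 * ‖A‖) := by
  have h1 : DiamondBounded (LinearMap.mulLeft ℂ A) ‖A‖ := by
    have h := (mulLeft_comp_mulRight A 1).mono (b := ‖A‖)
      (by nlinarith [norm_one_le (d := d), norm_nonneg A])
    rwa [LinearMap.mulRight_one, LinearMap.comp_id] at h
  have h2 : DiamondBounded (LinearMap.mulRight ℂ A) ‖A‖ := by
    have h := (mulLeft_comp_mulRight 1 A).mono (b := ‖A‖)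
      (by nlinarith [norm_one_le (d := d), norm_nonneg A])
    rwa [LinearMap.mulLeft_one, LinearMap.id_comp] at h
  exact ((h1.sub h2).smul Complex.I).mono (by simp; linarith)

theorem evolution {A : Matrix (Fin d) (Fin d) ℂ} (hA : A.IsHermitian) (s : ℝ) :
    DiamondBounded (evolution A s) 1 := by
  have hsk : (Complex.I * (s : ℂ)) • A ∈ skewAdjoint (Matrix (Fin d) (Fin d) ℂ) := by
    rw [skewAdjoint.mem_iff, star_smul, Matrix.star_eq_conjTranspose, hA.eq]
    simp
  have key : ∀ B ∈ skewAdjoint (Matrix (Fin d) (Fin d) ℂ), ‖NormedSpace.exp B‖ ≤ 1 := by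
    intro B hB
    let _ : NormedAlgebra ℚ (Matrix (Fin d) (Fin d) ℂ) := NormedAlgebra.restrictScalars ℚ ℂ _
    have hu := NormedSpace.exp_mem_unitary_of_mem_skewAdjoint hB
    have := CStarRing.norm_coe_unitary_mul ⟨_, hu⟩ (1 : Matrix (Fin d) (Fin d) ℂ)
    rw [mul_one] at this
    exact this.le.trans norm_one_le
  refine (mulLeft_comp_mulRight _ _).mono ?_
  exact mul_le_one₀ (key _ hsk) (norm_nonneg _) (key _ (neg_mem hsk))

/-- A bound for the diamond norm passes to limits, in any Banach algebra `𝔸` which is isomorphic to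
the algebra of superoperators. -/
theorem of_tendsto {𝔸 : Type} [NormedRing 𝔸] [NormedAlgebra ℂ 𝔸] (e : SuperOp d ≃ₐ[ℂ] 𝔸)
    {F : ℕ → SuperOp d}
    (hF : Filter.Tendsto (fun M => e (F M)) Filter.atTop (nhds (e Φ)))
    (h : ∀ᶠ M in Filter.atTop, DiamondBounded (F M) a) : DiamondBounded Φ a := by
  intro n X
  refine traceNorm_le_iff.2 fun W hW => ?_
  let f : 𝔸 →ₗ[ℂ] ℂ := Matrix.traceLinearMap _ ℂ ℂ ∘ₗ LinearMap.mulLeft ℂ W ∘ₗ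
    ampliateLinear n X ∘ₗ e.symm.toLinearMap
  have hf : ∀ Ψ : SuperOp d, f (e Ψ) = (W * ampliate Ψ n X).trace := fun Ψ => by
    simp [f, ampliateLinear_apply]
  have hfin : FiniteDimensional ℂ 𝔸 := Module.Finite.equiv e.toLinearEquiv
  have hc : Continuous f := f.continuous_of_finiteDimensional
  have ht := (hc.tendsto _).comp hF |>.norm
  rw [hf] at ht
  refine le_of_tendsto ht (h.mono fun M hM => ?_)
  simp only [Function.comp_apply, hf]
  exact traceNorm_le_iff.1 (hM n X) W hW

end DiamondBounded

end Diamond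

/-! ### Evolutions as exponentials of commutators -/

/-! The exponential series are summed in an arbitrary Banach algebra `𝔸` with an isomorphism
`e : SuperOp d ≃ₐ[ℂ] 𝔸`, because `SuperOp d` carries no topology. -/

section Evolution

open scoped Matrix.Norms.L2Operator
open Filter Topology

variable {d : ℕ} {𝔸 : Type} [NormedRing 𝔸] [NormedAlgebra ℂ 𝔸] [CompleteSpace 𝔸]
  (e : SuperOp d ≃ₐ[ℂ] 𝔸)

theorem exp_map_mulLeft (A : Matrix (Fin d) (Fin d) ℂ) :
    NormedSpace.exp (e (LinearMap.mulLeft ℂ A)) =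
      e (LinearMap.mulLeft ℂ (NormedSpace.exp A)) := by
  have h1 := NormedSpace.exp_series_hasSum_exp' (𝕂 := ℂ) (e (LinearMap.mulLeft ℂ A))
  let f : Matrix (Fin d) (Fin d) ℂ →ₗ[ℂ] _ := e.toLinearMap ∘ₗ LinearMap.mul ℂ _
  have hf : Continuous f := f.continuous_of_finiteDimensional
  have h2 := (NormedSpace.exp_series_hasSum_exp' (𝕂 := ℂ) A).map f hf
  have hfun : f ∘ (fun n : ℕ => (n.factorial : ℂ)⁻¹ • A ^ n) =
      fun n : ℕ => (n.factorial : ℂ)⁻¹ • e (LinearMap.mulLeft ℂ A) ^ n := by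
    ext n
    rw [Function.comp_apply, map_smul, ← map_pow, LinearMap.pow_mulLeft]
    rfl
  rw [hfun] at h2
  exact h1.unique h2

theorem exp_map_mulRight (A : Matrix (Fin d) (Fin d) ℂ) :
    NormedSpace.exp (e (LinearMap.mulRight ℂ A)) =
      e (LinearMap.mulRight ℂ (NormedSpace.exp A)) := by
  have h1 := NormedSpace.exp_series_hasSum_exp' (𝕂 := ℂ) (e (LinearMap.mulRight ℂ A))
  let f : Matrix (Fin d) (Fin d) ℂ →ₗ[ℂ] _ := e.toLinearMap ∘ₗ (LinearMap.mul ℂ _).flip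
  have hf : Continuous f := f.continuous_of_finiteDimensional
  have h2 := (NormedSpace.exp_series_hasSum_exp' (𝕂 := ℂ) A).map f hf
  have hfun : f ∘ (fun n : ℕ => (n.factorial : ℂ)⁻¹ • A ^ n) =
      fun n : ℕ => (n.factorial : ℂ)⁻¹ • e (LinearMap.mulRight ℂ A) ^ n := by
    ext n
    rw [Function.comp_apply, map_smul, ← map_pow, LinearMap.pow_mulRight]
    rfl
  rw [hfun] at h2
  exact h1.unique h2

theorem map_evolution (A : Matrix (Fin d) (Fin d) ℂ) (s : ℝ) :
    e (evolution A s) = NormedSpace.exp ((s : ℂ) • e (commOp A)) := by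
  let _ : NormedAlgebra ℚ 𝔸 :=
    NormedAlgebra.restrictScalars ℚ ℂ _
  have h : (s : ℂ) • e (commOp A) =
      e (LinearMap.mulLeft ℂ ((Complex.I * (s : ℂ)) • A)) +
        e (LinearMap.mulRight ℂ (-((Complex.I * (s : ℂ)) • A))) := by
    rw [← map_smul, ← map_add]
    congr 1
    ext1 X
    simp [commOp, smul_smul, mul_comm, sub_eq_add_neg]
  have hc : Commute (e (LinearMap.mulLeft ℂ ((Complex.I * (s : ℂ)) • A)))
      (e (LinearMap.mulRight ℂ (-((Complex.I * (s : ℂ)) • A)))) :=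
    (LinearMap.commute_mulLeft_right _ _).map e
  rw [h, NormedSpace.exp_add_of_commute hc, exp_map_mulLeft e, exp_map_mulRight e, ← map_mul]
  rfl

theorem hasSum_evolution (A : Matrix (Fin d) (Fin d) ℂ) (s : ℝ) :
    HasSum (fun n : ℕ => ((s : ℂ) ^ n * (n.factorial : ℂ)⁻¹) • e (commOp A ^ n))
      (e (evolution A s)) := by
  rw [map_evolution e]
  convert NormedSpace.exp_series_hasSum_exp' (𝕂 := ℂ) ((s : ℂ) • e (commOp A)) using 2 with n
  rw [smul_pow, smul_smul, mul_comm, map_pow]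

end Evolution

section Data

open scoped Matrix.Norms.L2Operator
open Filter Topology

variable {d L : ℕ} {h : Fin L → ℝ} {H : Fin L → Matrix (Fin d) (Fin d) ℂ} {t : ℝ} {N : ℕ}
  {𝔸 : Type} [NormedRing 𝔸] [NormedAlgebra ℂ 𝔸] [CompleteSpace 𝔸] (e : SuperOp d ≃ₐ[ℂ] 𝔸)

theorem evolution_nat_mul (A : Matrix (Fin d) (Fin d) ℂ) (s : ℝ) (N : ℕ) :
    evolution A (N * s) = evolution A s ^ N := by
  let _ : NormedAlgebra ℚ (Matrix (Fin d) (Fin d) ℂ) := NormedAlgebra.restrictScalars ℚ ℂ _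
  have h1 : (Complex.I * ((N * s : ℝ) : ℂ)) • A = N • ((Complex.I * (s : ℂ)) • A) := by
    rw [← Nat.cast_smul_eq_nsmul ℂ, smul_smul]
    push_cast
    congr 1
    ring
  rw [evolution, evolution, h1, ← smul_neg, NormedSpace.exp_nsmul, NormedSpace.exp_nsmul,
    ← LinearMap.pow_mulLeft, ← LinearMap.pow_mulRight]
  exact ((LinearMap.commute_mulLeft_right _ _).mul_pow N).symm

theorem commOp_smul (c : ℂ) (A : Matrix (Fin d) (Fin d) ℂ) : commOp (c • A) = c • commOp A := by
  ext1 X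
  simp [commOp, smul_sub, smul_smul, mul_comm]

theorem lOp_eq : lOp h H = commOp (((lam h)⁻¹ : ℂ) • ham h H) := by
  rw [lOp, commOp_smul]

theorem lOp_eq_sum : lOp h H = ∑ l, (prob h l : ℂ) • commOp (H l) := by
  have hsum : commOp (ham h H) = ∑ l, (h l : ℂ) • commOp (H l) := by
    ext1 X
    simp [commOp, ham, Finset.sum_mul, Finset.mul_sum, LinearMap.sum_apply, smul_sub,
      Finset.smul_sum, Finset.sum_sub_distrib, smul_comm Complex.I]
  rw [lOp, hsum, Finset.smul_sum]
  refine Finset.sum_congr rfl fun l _ => ?_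
  rw [smul_smul, prob]
  push_cast
  rw [mul_comm, div_eq_mul_inv]

theorem sum_prob (hlam : lam h ≠ 0) : ∑ l, prob h l = 1 := by
  simp only [prob, ← Finset.sum_div]
  exact div_self hlam

theorem lDiff_zero (hlam : lam h ≠ 0) : lDiff h H 0 = 0 := by
  simp only [lDiff, pow_zero, ← Finset.sum_smul, ← Complex.ofReal_sum, sum_prob hlam]
  simp

theorem lDiff_one : lDiff h H 1 = 0 := by
  simp only [lDiff, pow_one, lOp_eq_sum, sub_self]

/-- The expansion of one step: `exp (s ℒ) - ∑ p_ℓ exp (s ℒ_ℓ) = ∑ s^n / n! ℒ^{(n)}`. -/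
theorem hasSum_lDiff (s : ℝ) :
    HasSum (fun n : ℕ => ((s : ℂ) ^ n * (n.factorial : ℂ)⁻¹) • e (lDiff h H n))
      (e (evolution (((lam h)⁻¹ : ℂ) • ham h H) s) -
        e (∑ l, (prob h l : ℂ) • evolution (H l) s)) := by
  have h1 := hasSum_evolution e (((lam h)⁻¹ : ℂ) • ham h H) s
  have h2 := hasSum_sum (s := Finset.univ)
    fun l _ => (hasSum_evolution e (H l) s).const_smul (prob h l : ℂ)
  have h3 := h1.sub h2
  simp only [map_sum, map_smul]
  have hfun : (fun n : ℕ => ((s : ℂ) ^ n * (n.factorial : ℂ)⁻¹) • e (lDiff h H n)) = fun n : ℕ =>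
      ((s : ℂ) ^ n * (n.factorial : ℂ)⁻¹) • e (commOp (((lam h)⁻¹ : ℂ) • ham h H) ^ n) -
        ∑ l, (prob h l : ℂ) • ((s : ℂ) ^ n * (n.factorial : ℂ)⁻¹) • e (commOp (H l) ^ n) := by
    ext n
    rw [lDiff, lOp_eq, map_sub, map_sum, smul_sub, Finset.smul_sum]
    congr 1
    refine Finset.sum_congr rfl fun l _ => ?_
    rw [map_smul, smul_comm]
  rw [hfun]
  exact h3

theorem idealU_eq (hlam : lam h ≠ 0) (hN : N ≠ 0) :
    idealU h H t = evolution (((lam h)⁻¹ : ℂ) • ham h H) (tau h t N) ^ N := by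
  rw [← evolution_nat_mul, idealU, evolution, evolution]
  have : (Complex.I * ((N * tau h t N : ℝ) : ℂ)) • ((lam h : ℂ)⁻¹ • ham h H) =
      (Complex.I * (t : ℂ)) • ham h H := by
    have hN' : (N : ℂ) ≠ 0 := by exact_mod_cast hN
    have hl : (lam h : ℂ) ≠ 0 := by exact_mod_cast hlam
    rw [smul_smul, tau]
    congr 1
    push_cast
    field_simp
  rw [this]

/-- The ideal channel is the limit of the `N`-th powers of `E_N` plus the partial sums of `Δ₂`. -/
theorem tendsto_idealU (hlam : lam h ≠ 0) (hN : N ≠ 0) :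
    Tendsto (fun M : ℕ => e
      ((∑ n ∈ Finset.Icc 2 M, ((tau h t N : ℂ) ^ n * (n.factorial : ℂ)⁻¹) • lDiff h H n +
        qdrift h H t N) ^ N)) atTop (𝓝 (e (idealU h H t))) := by
  rw [idealU_eq hlam hN, map_pow]
  simp only [map_pow, map_add]
  refine Tendsto.pow ?_ N
  have h1 := ((hasSum_lDiff e (h := h) (H := H) (tau h t N)).tendsto_sum_nat.comp
    (tendsto_add_atTop_nat 1)).add_const (e (qdrift h H t N))
  rw [← qdrift, sub_add_cancel] at h1
  refine h1.congr fun M => ?_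
  simp only [Function.comp_apply, map_sum, map_smul]
  congr 1
  refine (Finset.sum_subset (fun n hn => ?_) fun n _ hn' => ?_).symm
  · simp only [Finset.mem_Icc, Finset.mem_range] at hn ⊢; omega
  · have : n = 0 ∨ n = 1 := by
      simp only [Finset.mem_Icc, Finset.mem_range] at *; omega
    rcases this with rfl | rfl
    · rw [lDiff_zero hlam, map_zero, smul_zero]
    · rw [lDiff_one, map_zero, smul_zero]

theorem diamondBounded_idealU (hH : ∀ l, (H l).IsHermitian) :
    DiamondBounded (idealU h H t) 1 := by
  refine DiamondBounded.evolution ?_ t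
  rw [Matrix.IsHermitian, ham, Matrix.conjTranspose_sum]
  refine Finset.sum_congr rfl fun l _ => ?_
  rw [Matrix.conjTranspose_smul, (hH l).eq]
  simp

theorem prob_nonneg (hh : ∀ l, 0 ≤ h l) (l : Fin L) : 0 ≤ prob h l :=
  div_nonneg (hh l) (Finset.sum_nonneg fun l _ => hh l)

/-- A mixture with weights `p_ℓ` is bounded by a common bound of its members. -/
theorem diamondBounded_sum_prob (hh : ∀ l, 0 ≤ h l) (hlam : lam h ≠ 0) {F : Fin L → SuperOp d}
    {c : ℝ} (hF : ∀ l, DiamondBounded (F l) c) :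
    DiamondBounded (∑ l, (prob h l : ℂ) • F l) c := by
  have := DiamondBounded.sum Finset.univ fun l _ => (hF l).smul (prob h l : ℂ)
  simpa only [Complex.norm_real, Real.norm_eq_abs, abs_of_nonneg (prob_nonneg hh _),
    ← Finset.sum_mul, sum_prob hlam, one_mul] using this

theorem diamondBounded_qdrift (hh : ∀ l, 0 ≤ h l) (hH : ∀ l, (H l).IsHermitian)
    (hlam : lam h ≠ 0) : DiamondBounded (qdrift h H t N) 1 :=
  diamondBounded_sum_prob hh hlam fun l => DiamondBounded.evolution (hH l) _

theorem diamondBounded_lDiff (hh : ∀ l, 0 ≤ h l) (hlam : lam h ≠ 0)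
    (hn : ∀ l, ‖Matrix.toEuclideanCLM (n := Fin d) (𝕜 := ℂ) (H l)‖ = 1) (n : ℕ) :
    DiamondBounded (lDiff h H n) (2 ^ n * 2) := by
  have h1 : ∀ l, DiamondBounded (commOp (H l)) 2 := fun l =>
    (DiamondBounded.commOp (H l)).mono (by rw [Matrix.cstar_norm_def, hn l, mul_one])
  have h2 : DiamondBounded (lOp h H) 2 := by
    rw [lOp_eq_sum]; exact diamondBounded_sum_prob hh hlam h1
  have h3 := (h2.pow zero_le_two n).sub
    (diamondBounded_sum_prob hh hlam fun l => (h1 l).pow zero_le_two n)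
  exact h3.mono (by linarith)

end Data

/-! ### Coefficients of the expansion in powers of `τ` -/

section Coefficients

variable {d L : ℕ} {h : Fin L → ℝ} {H : Fin L → Matrix (Fin d) (Fin d) ℂ} {t : ℝ} {N : ℕ}

/-- The part of total degree `ξ` in the expansion of `(E_N + ∑_{n ∈ S} τ^n / n! ℒ^{(n)})^N`, the
factors `E_N` not being expanded. For `S = {2, …, ξ}` this is `qswiftCoeff`. -/
def mixtureCoeff (h : Fin L → ℝ) (H : Fin L → Matrix (Fin d) (Fin d) ℂ) (t : ℝ) (N : ℕ)
    (S : Finset ℕ) (ξ : ℕ) : SuperOp d :=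
  ∑ k ∈ Finset.Icc 1 N, ∑ n ∈ Fintype.piFinset (fun _ : Fin k => S),
    if ξ = ∑ j, n j then
      (∏ j, ((n j).factorial : ℂ))⁻¹ •
        mixture (fun j => lDiff h H (n j)) (fun _ : Fin (N - k) => qdrift h H t N)
    else 0

theorem mixtureCoeff_Icc {M ξ : ℕ} (hξ : ξ ≤ M) :
    mixtureCoeff h H t N (Finset.Icc 2 M) ξ = qswiftCoeff h H t N ξ := by
  refine Finset.sum_congr rfl fun k _ => (Finset.sum_subset ?_ ?_).symm
  · exact Fintype.piFinset_subset _ _ fun _ => Finset.Icc_subset_Icc_right hξ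
  · intro n hn hn'
    refine if_neg fun hsum => hn' ?_
    simp only [Fintype.mem_piFinset, Finset.mem_Icc] at hn ⊢
    refine fun j => ⟨(hn j).1, ?_⟩
    rw [hsum]
    exact Finset.single_le_sum (f := n) (fun _ _ => Nat.zero_le _) (Finset.mem_univ j)

theorem two_mul_le_sum {k M : ℕ} {n : Fin k → ℕ}
    (hn : n ∈ Fintype.piFinset fun _ : Fin k => Finset.Icc 2 M) : 2 * k ≤ ∑ j, n j := by
  have := Finset.sum_le_sum (f := fun _ => 2) (g := n) (s := Finset.univ)
    fun j _ => (Finset.mem_Icc.1 (Fintype.mem_piFinset.1 hn j)).1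
  simpa [mul_comm] using this

theorem mixtureCoeff_eq_zero {M ξ : ℕ} (hξ : ξ < 2) :
    mixtureCoeff h H t N (Finset.Icc 2 M) ξ = 0 := by
  refine Finset.sum_eq_zero fun k hk => Finset.sum_eq_zero fun n hn => if_neg fun hsum => ?_
  have := two_mul_le_sum hn
  have := (Finset.mem_Icc.1 hk).1
  omega

/-- The power of `E_N` plus a partial sum of `Δ₂`, collected by the degree in `τ`. The
largest degree that occurs is `N * M`. -/
theorem pow_eq_sum_mixtureCoeff {M T : ℕ} (hT : N * M < T) :
    (∑ n ∈ Finset.Icc 2 M, ((tau h t N : ℂ) ^ n * (n.factorial : ℂ)⁻¹) • lDiff h H n +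
        qdrift h H t N) ^ N =
      qdrift h H t N ^ N + ∑ ξ ∈ Finset.range T,
        (tau h t N : ℂ) ^ ξ • mixtureCoeff h H t N (Finset.Icc 2 M) ξ := by
  refine (sum_smul_add_pow (Finset.Icc 2 M) (fun n => (tau h t N : ℂ) ^ n * (n.factorial : ℂ)⁻¹)
    (lDiff h H) (qdrift h H t N) N).trans ?_
  congr 1
  simp only [mixtureCoeff, Finset.smul_sum]
  rw [Finset.sum_comm]
  refine Finset.sum_congr rfl fun k hk => ?_
  rw [Finset.sum_comm]
  refine Finset.sum_congr rfl fun n hn => ?_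
  have hmem : ∑ j, n j ∈ Finset.range T := by
    have h1 := Finset.sum_le_sum (f := n) (g := fun _ => M) (s := Finset.univ)
      fun j _ => (Finset.mem_Icc.1 (Fintype.mem_piFinset.1 hn j)).2
    have h2 : k * M ≤ N * M := Nat.mul_le_mul_right M (Finset.mem_Icc.1 hk).2
    simp only [Finset.sum_const, Finset.card_univ, Fintype.card_fin, smul_eq_mul] at h1
    exact Finset.mem_range.2 (by omega)
  rw [Finset.sum_eq_single_of_mem _ hmem fun ξ _ hξ => by rw [if_neg hξ, smul_zero], if_pos rfl,
    smul_smul, Finset.prod_mul_distrib, Finset.prod_pow_eq_pow_sum, Finset.prod_inv_distrib]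

theorem sum_Icc_inv_factorial_le_one (M : ℕ) :
    ∑ n ∈ Finset.Icc 2 M, ((n.factorial : ℝ))⁻¹ ≤ 1 := by
  have h1 := Real.sum_le_exp_of_nonneg zero_le_one (M + 2)
  have h2 : ∑ n ∈ Finset.Icc 2 M, ((n.factorial : ℝ))⁻¹ ≤
      ∑ n ∈ Finset.range M, (((n + 2).factorial : ℝ))⁻¹ := by
    rw [Finset.range_eq_Ico, Finset.sum_Ico_add' (fun n : ℕ => ((n.factorial : ℝ))⁻¹) 0 M 2]
    refine Finset.sum_le_sum_of_subset_of_nonneg (fun n hn => ?_) fun _ _ _ => by positivity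
    simp only [Finset.mem_Icc, Finset.mem_Ico] at hn ⊢
    omega
  rw [Finset.sum_range_succ', Finset.sum_range_succ'] at h1
  simp only [one_pow, one_div, Nat.factorial_zero, zero_add, Nat.factorial_one, Nat.cast_one,
    inv_one] at h1
  linarith [Real.exp_one_lt_d9]

theorem sum_two_pow_div_factorial_le (N : ℕ) :
    ∑ k ∈ Finset.Icc 1 N, (2 : ℝ) ^ k / k.factorial ≤ Real.exp 2 := by
  refine le_trans ?_ (Real.sum_le_exp_of_nonneg zero_le_two (N + 1))
  refine Finset.sum_le_sum_of_subset_of_nonneg (fun n hn => ?_) fun _ _ _ => by positivity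
  simp only [Finset.mem_Icc, Finset.mem_range] at hn ⊢
  omega

/-- One term of the coefficient of `τ^ξ`: it vanishes unless `k ≤ ξ / 2`, and `N.choose k` is at
most `N ^ k / k!`. -/
theorem diamondBounded_term (hh : ∀ l, 0 ≤ h l) (hH : ∀ l, (H l).IsHermitian)
    (hlam : lam h ≠ 0) (hn : ∀ l, ‖Matrix.toEuclideanCLM (n := Fin d) (𝕜 := ℂ) (H l)‖ = 1)
    {k M ξ : ℕ} (hk : 1 ≤ k) (hkN : k ≤ N) {n : Fin k → ℕ}
    (hmem : n ∈ Fintype.piFinset fun _ : Fin k => Finset.Icc 2 M) :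
    DiamondBounded (if ξ = ∑ j, n j then
      (∏ j, ((n j).factorial : ℂ))⁻¹ •
        mixture (fun j => lDiff h H (n j)) (fun _ : Fin (N - k) => qdrift h H t N)
      else 0) (2 ^ ξ * N ^ (ξ / 2) * (2 ^ k / k.factorial * ∏ j, ((n j).factorial : ℝ)⁻¹)) := by
  split_ifs with hξ
  · refine ((DiamondBounded.mixture (fun j => by positivity)
      (fun j => diamondBounded_lDiff hh hlam hn (n j))
      (diamondBounded_qdrift hh hH hlam)).smul _).mono ?_
    rw [Nat.add_sub_cancel' hkN, Finset.prod_mul_distrib, Finset.prod_pow_eq_pow_sum, ← hξ,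
      Finset.prod_const, Finset.card_univ, Fintype.card_fin, norm_inv, norm_prod]
    simp only [Complex.norm_natCast]
    rw [Finset.prod_inv_distrib]
    have h1 : (N.choose k : ℝ) ≤ N ^ (ξ / 2) / k.factorial := by
      refine (Nat.choose_le_pow_div k N).trans ?_
      have hN : (1 : ℝ) ≤ N := by exact_mod_cast hk.trans hkN
      have := two_mul_le_sum hmem
      gcongr
      omega
    calc (∏ j, ((n j).factorial : ℝ))⁻¹ * ((N.choose k : ℝ) * (2 ^ ξ * 2 ^ k))
        ≤ (∏ j, ((n j).factorial : ℝ))⁻¹ * (N ^ (ξ / 2) / k.factorial * (2 ^ ξ * 2 ^ k)) := by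
          gcongr
      _ = _ := by ring
  · exact DiamondBounded.zero.mono (by positivity)

/-- The coefficient of `τ^ξ` is at most `(2e)^ξ N^⌊ξ/2⌋` in diamond norm. The factor `e^ξ` absorbs
`∑ 2^k / k! ≤ e²`, which needs `ξ ≥ 2`; in lower degrees the coefficient is `0`. -/
theorem diamondBounded_mixtureCoeff (hh : ∀ l, 0 ≤ h l) (hH : ∀ l, (H l).IsHermitian)
    (hlam : lam h ≠ 0) (hn : ∀ l, ‖Matrix.toEuclideanCLM (n := Fin d) (𝕜 := ℂ) (H l)‖ = 1)
    (M ξ : ℕ) :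
    DiamondBounded (mixtureCoeff h H t N (Finset.Icc 2 M) ξ)
      ((2 * Real.exp 1) ^ ξ * N ^ (ξ / 2)) := by
  rcases lt_or_ge ξ 2 with hξ | hξ
  · rw [mixtureCoeff_eq_zero hξ]
    exact DiamondBounded.zero.mono (by positivity)
  refine (DiamondBounded.sum _ fun k hk => DiamondBounded.sum _ fun n hmem =>
    diamondBounded_term hh hH hlam hn (Finset.mem_Icc.1 hk).1 (Finset.mem_Icc.1 hk).2 hmem).mono ?_
  simp only [← Finset.mul_sum]
  have h1 : ∑ k ∈ Finset.Icc 1 N, (2 : ℝ) ^ k / k.factorial *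
      ∑ n ∈ Fintype.piFinset (fun _ : Fin k => Finset.Icc 2 M), ∏ j, ((n j).factorial : ℝ)⁻¹ ≤
      Real.exp 2 := by
    refine (Finset.sum_le_sum fun k _ => ?_).trans (sum_two_pow_div_factorial_le N)
    refine mul_le_of_le_one_right (by positivity) ?_
    rw [← Finset.prod_univ_sum (fun _ : Fin k => Finset.Icc 2 M)
      (fun _ m => ((m.factorial : ℝ))⁻¹)]
    exact Finset.prod_le_one
      (fun _ _ => Finset.sum_nonneg fun _ _ => by positivity)
      (fun _ _ => sum_Icc_inv_factorial_le_one M)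
  have h2 : Real.exp 2 ≤ Real.exp 1 ^ ξ := by
    rw [← Real.exp_nat_mul, mul_one]
    exact Real.exp_le_exp.2 (by exact_mod_cast hξ)
  calc _ ≤ (2 : ℝ) ^ ξ * N ^ (ξ / 2) * Real.exp 1 ^ ξ := by
        gcongr
        exact h1.trans h2
    _ = _ := by ring

end Coefficients

/-! ### Summation of the tail -/

/-- The bound `(2 e τ)^ξ N^⌊ξ/2⌋` for the part of degree `ξ`, in terms of `y = 2 e λ t`. The
division `ξ / 2` is that of natural numbers. -/
def degreeBound (y : ℝ) (N ξ : ℕ) : ℝ := (y / N) ^ ξ * N ^ (ξ / 2)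

theorem degreeBound_even {y : ℝ} {N : ℕ} (hN : N ≠ 0) (j : ℕ) :
    degreeBound y N (2 * j) = (y ^ 2 / N) ^ j := by
  have : (N : ℝ) ≠ 0 := by exact_mod_cast hN
  rw [degreeBound, Nat.mul_div_cancel_left j two_pos, pow_mul, ← mul_pow]
  congr 1
  field_simp

theorem degreeBound_odd {y : ℝ} (hy : y ≠ 0) {N : ℕ} (hN : N ≠ 0) (j : ℕ) :
    degreeBound y N (2 * j + 1) = 1 / y * (y ^ 2 / N) ^ (j + 1) := by
  have hN' : (N : ℝ) ≠ 0 := by exact_mod_cast hN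
  rw [degreeBound, show (2 * j + 1) / 2 = j by omega, pow_succ, pow_mul, mul_right_comm, ← mul_pow,
    show (y / N) ^ 2 * N = y ^ 2 / N by field_simp, pow_succ (y ^ 2 / N)]
  field_simp

theorem sum_degreeBound {y : ℝ} (hy : y ≠ 0) {N : ℕ} (hN : N ≠ 0) (k J : ℕ) :
    ∑ ξ ∈ Finset.Ico (2 * k + 1) (2 * k + 1 + 2 * J), degreeBound y N ξ =
      (1 + 1 / y) * ((y ^ 2 / N) ^ (k + 1) * ∑ j ∈ Finset.range J, (y ^ 2 / N) ^ j) := by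
  induction J with
  | zero => simp
  | succ J ih =>
    rw [show 2 * k + 1 + 2 * (J + 1) = 2 * k + 1 + 2 * J + 1 + 1 by ring,
      Finset.sum_Ico_succ_top (by omega), Finset.sum_Ico_succ_top (by omega), ih,
      show 2 * k + 1 + 2 * J = 2 * (k + J) + 1 by ring, degreeBound_odd hy hN,
      show 2 * (k + J) + 1 + 1 = 2 * (k + J + 1) by ring, degreeBound_even hN,
      Finset.sum_range_succ]
    ring

theorem sum_degreeBound_le {y : ℝ} (hy : 0 < y) {N : ℕ} (hN : N ≠ 0) (hr : y ^ 2 / N < 1)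
    (k J : ℕ) :
    ∑ ξ ∈ Finset.Ico (2 * k + 1) (2 * k + 1 + 2 * J), degreeBound y N ξ ≤
      (1 + 1 / y) * ((y ^ 2 / N) ^ (k + 1) * (1 / (1 - y ^ 2 / N))) := by
  rw [sum_degreeBound hy.ne' hN]
  have hr0 : 0 ≤ y ^ 2 / N := by positivity
  have : ∑ j ∈ Finset.range J, (y ^ 2 / N) ^ j ≤ 1 / (1 - y ^ 2 / N) := by
    rw [one_div, ← tsum_geometric_of_lt_one hr0 hr]
    exact (summable_geometric_of_lt_one hr0 hr).sum_le_tsum _ fun _ _ => by positivity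
  gcongr

/-- In the regime `2 r ≥ 1`, with `r = y² / N`, every degree up to `2 K` contributes at most
`(2 r)^K`. -/
theorem degreeBound_le {y : ℝ} (hy : 1 ≤ y) {N : ℕ} (hN : N ≠ 0) (hr : 1 ≤ 2 * (y ^ 2 / N))
    {K ξ : ℕ} (hξ : ξ ≤ 2 * K) : degreeBound y N ξ ≤ (2 * (y ^ 2 / N)) ^ K := by
  have hr0 : 0 ≤ y ^ 2 / N := by positivity
  have key : ∀ j ≤ K, (y ^ 2 / N) ^ j ≤ (2 * (y ^ 2 / N)) ^ K := fun j hj =>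
    (pow_le_pow_left₀ hr0 (by linarith) j).trans (pow_le_pow_right₀ hr hj)
  obtain ⟨j, rfl | rfl⟩ := Nat.even_or_odd' ξ
  · rw [degreeBound_even hN]
    exact key j (by omega)
  · rw [degreeBound_odd (by positivity) hN]
    refine (mul_le_of_le_one_left (by positivity) ?_).trans (key (j + 1) (by omega))
    exact div_le_one_of_le₀ hy (by positivity)

/-! ### The error of the qSWIFT channel -/

section Error

variable {d L : ℕ} {h : Fin L → ℝ} {H : Fin L → Matrix (Fin d) (Fin d) ℂ} {t : ℝ} {N : ℕ}

theorem diamondBounded_degree (hh : ∀ l, 0 ≤ h l) (hH : ∀ l, (H l).IsHermitian)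
    (hn : ∀ l, ‖Matrix.toEuclideanCLM (n := Fin d) (𝕜 := ℂ) (H l)‖ = 1)
    (hx : 0 < lam h * t) (M ξ : ℕ) :
    DiamondBounded ((tau h t N : ℂ) ^ ξ • mixtureCoeff h H t N (Finset.Icc 2 M) ξ)
      (degreeBound (2 * Real.exp 1 * (lam h * t)) N ξ) := by
  refine ((diamondBounded_mixtureCoeff hh hH (left_ne_zero_of_mul hx.ne') hn M ξ).smul _).mono
    (le_of_eq ?_)
  have hτ : 0 ≤ tau h t N := div_nonneg hx.le (Nat.cast_nonneg N)
  rw [norm_pow, Complex.norm_real, Real.norm_eq_abs, abs_of_nonneg hτ, degreeBound, tau,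
    ← mul_assoc, ← mul_pow]
  congr 2
  ring

/-- The qSWIFT channel of order `k + 1` is the part of degree at most `2 * k` of the expansion. The
degrees `0` and `1` may be included, since their coefficients vanish. -/
theorem qswift_eq (k : ℕ) {M : ℕ} (hM : 2 * k ≤ M) :
    qswift h H t N (k + 1) = qdrift h H t N ^ N + ∑ ξ ∈ Finset.range (2 * k + 1),
      (tau h t N : ℂ) ^ ξ • mixtureCoeff h H t N (Finset.Icc 2 M) ξ := by
  rw [qswift, show 2 * (k + 1) - 2 = 2 * k by omega]
  congr 1
  refine (Finset.sum_congr rfl fun ξ hξ => ?_).trans (Finset.sum_subset ?_ fun ξ hξ hξ' => ?_)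
  · rw [mixtureCoeff_Icc ((Finset.mem_Icc.1 hξ).2.trans hM)]
  · intro ξ hξ
    simp only [Finset.mem_Icc, Finset.mem_range] at hξ ⊢
    omega
  · rw [mixtureCoeff_eq_zero, smul_zero]
    simp only [Finset.mem_Icc, Finset.mem_range] at hξ hξ'
    omega

theorem diamondBounded_error (hh : ∀ l, 0 ≤ h l) (hH : ∀ l, (H l).IsHermitian)
    (hn : ∀ l, ‖Matrix.toEuclideanCLM (n := Fin d) (𝕜 := ℂ) (H l)‖ = 1)
    (hx : 0 < lam h * t) (hN : N ≠ 0) (hr : (2 * Real.exp 1 * (lam h * t)) ^ 2 / N < 1) (k : ℕ) :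
    DiamondBounded (idealU h H t - qswift h H t N (k + 1))
      (2 * (eta (lam h * t) N * ((2 * Real.exp 1 * (lam h * t)) ^ 2 / N) ^ (k + 1))) := by
  open scoped Matrix.Norms.L2Operator in
  refine DiamondBounded.of_tendsto (Module.End.toContinuousLinearMap (𝕜 := ℂ) _)
    (F := fun M => (∑ n ∈ Finset.Icc 2 M,
      ((tau h t N : ℂ) ^ n * (n.factorial : ℂ)⁻¹) • lDiff h H n + qdrift h H t N) ^ N -
        qswift h H t N (k + 1)) ?_ ?_
  · simp only [map_sub]
    exact (tendsto_idealU _ (left_ne_zero_of_mul hx.ne') hN).sub_const _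
  · filter_upwards [Filter.eventually_ge_atTop (2 * k)] with M hM
    -- the number of degrees in the tail is taken even, so that they pair up
    rw [pow_eq_sum_mixtureCoeff (T := 2 * k + 1 + 2 * (N * M)) (by omega), qswift_eq k hM,
      add_sub_add_left_eq_sub, ← Finset.sum_Ico_eq_sub _ (by omega)]
    refine (DiamondBounded.sum _ fun ξ _ => diamondBounded_degree hh hH hn hx M ξ).mono ?_
    refine (sum_degreeBound_le (by positivity) hN hr k (N * M)).trans (le_of_eq ?_)
    rw [eta]
    ring

theorem diamondBounded_qswift (hh : ∀ l, 0 ≤ h l) (hH : ∀ l, (H l).IsHermitian)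
    (hn : ∀ l, ‖Matrix.toEuclideanCLM (n := Fin d) (𝕜 := ℂ) (H l)‖ = 1)
    (hx : 0 < lam h * t) (k : ℕ) :
    DiamondBounded (qswift h H t N (k + 1))
      (1 + ∑ ξ ∈ Finset.Icc 2 (2 * k), degreeBound (2 * Real.exp 1 * (lam h * t)) N ξ) := by
  have h1 := (diamondBounded_qdrift (t := t) (N := N) hh hH (left_ne_zero_of_mul hx.ne')).pow
    zero_le_one N
  rw [one_pow] at h1
  exact h1.add (DiamondBounded.sum _ fun ξ _ => diamondBounded_degree hh hH hn hx ξ ξ)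

theorem eta_le {x : ℝ} (hx : 1 ≤ x) (hr : (2 * Real.exp 1 * x) ^ 2 / N ≤ 1 / 2) :
    eta x N ≤ 3 / 2 := by
  have he : (2 : ℝ) ≤ Real.exp 1 := by linarith [Real.exp_one_gt_d9]
  have h1 : 1 / (2 * Real.exp 1 * x) ≤ 1 / 2 :=
    one_div_le_one_div_of_le two_pos (by nlinarith)
  have h2 : 1 / (1 - (2 * Real.exp 1 * x) ^ 2 / N) ≤ 1 / (1 / 2) :=
    one_div_le_one_div_of_le (by norm_num) (by linarith)
  calc eta x N ≤ 1 / 2 * (1 + 1 / 2) * (1 / (1 / 2)) := by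
        rw [eta]
        have h3 : 0 < 1 - (2 * Real.exp 1 * x) ^ 2 / N := by linarith
        gcongr
    _ = 3 / 2 := by norm_num

theorem diamondDist_le_eta (hh : ∀ l, 0 ≤ h l) (hH : ∀ l, (H l).IsHermitian)
    (hn : ∀ l, ‖Matrix.toEuclideanCLM (n := Fin d) (𝕜 := ℂ) (H l)‖ = 1)
    (hx : 0 < lam h * t) (hN : N ≠ 0) (hr : (2 * Real.exp 1 * (lam h * t)) ^ 2 / N < 1) (k : ℕ) :
    diamondDist (idealU h H t) (qswift h H t N (k + 1)) ≤
      ENNReal.ofReal (eta (lam h * t) N *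
        ((2 * Real.exp 1 * (lam h * t)) ^ 2 / N) ^ (k + 1)) := by
  refine (diamondBounded_error hh hH hn hx hN hr k).diamondDist_le ?_
  have h1 : 0 < 1 - (2 * Real.exp 1 * (lam h * t)) ^ 2 / N := by linarith
  rw [eta]
  positivity

/-- If `(2 e λ t)² / N` is not small, the bound holds because both channels are bounded. -/
theorem diamondDist_le_of_half_le (hh : ∀ l, 0 ≤ h l) (hH : ∀ l, (H l).IsHermitian)
    (hn : ∀ l, ‖Matrix.toEuclideanCLM (n := Fin d) (𝕜 := ℂ) (H l)‖ = 1)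
    (hx : 1 ≤ lam h * t) (hN : N ≠ 0)
    (hr : 1 / 2 ≤ (2 * Real.exp 1 * (lam h * t)) ^ 2 / N) (k : ℕ) :
    diamondDist (idealU h H t) (qswift h H t N (k + 1)) ≤
      ENNReal.ofReal ((k + 1) *
        (2 * ((2 * Real.exp 1 * (lam h * t)) ^ 2 / N)) ^ (k + 1)) := by
  have he : (2 : ℝ) ≤ Real.exp 1 := by linarith [Real.exp_one_gt_d9]
  have hy : 1 ≤ 2 * Real.exp 1 * (lam h * t) := by nlinarith
  have hr' : 1 ≤ 2 * ((2 * Real.exp 1 * (lam h * t)) ^ 2 / N) := by linarith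
  refine (((diamondBounded_idealU hH).sub
    (diamondBounded_qswift hh hH hn (by linarith) k)).mono ?_).diamondDist_le (by positivity)
  have h1 : ∑ ξ ∈ Finset.Icc 2 (2 * k), degreeBound (2 * Real.exp 1 * (lam h * t)) N ξ ≤
      2 * k * (2 * ((2 * Real.exp 1 * (lam h * t)) ^ 2 / N)) ^ (k + 1) := by
    refine (Finset.sum_le_card_nsmul _ _ _ fun ξ hξ => degreeBound_le hy hN hr' (K := k + 1)
      (by have := (Finset.mem_Icc.1 hξ).2; omega)).trans ?_
    rw [nsmul_eq_mul]
    refine mul_le_mul_of_nonneg_right ?_ (by positivity)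
    rw [Nat.card_Icc]
    exact_mod_cast (by omega : 2 * k + 1 - 2 ≤ 2 * k)
  have h2 := one_le_pow₀ hr' (n := k + 1)
  linarith

end Error

end QSwift

end

theorem lemma2 (K : ℕ) (hK : 1 ≤ K) :
    ∃ C : ℝ, ∀ (d L N : ℕ) (h : Fin L → ℝ) (H : Fin L → Matrix (Fin d) (Fin d) ℂ) (t : ℝ),
      (∀ l, 0 ≤ h l) →
      (∀ l, (H l).IsHermitian) →
      (∀ l, ‖Matrix.toEuclideanCLM (n := Fin d) (𝕜 := ℂ) (H l)‖ = 1) →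
      K ≤ N →
      -- the asymptotic bound, with a constant that depends on `K` only
      (1 ≤ QSwift.lam h * t →
        QSwift.diamondDist (QSwift.idealU h H t) (QSwift.qswift h H t N K) ≤
          ENNReal.ofReal (C * ((QSwift.lam h * t) ^ 2 / N) ^ K)) ∧
      -- the explicit bound
      (0 < QSwift.lam h * t → (2 * Real.exp 1 * (QSwift.lam h * t)) ^ 2 / N < 1 →
        QSwift.diamondDist (QSwift.idealU h H t) (QSwift.qswift h H t N K) ≤
          ENNReal.ofReal (QSwift.eta (QSwift.lam h * t) N *
            ((2 * Real.exp 1 * (QSwift.lam h * t)) ^ 2 / N) ^ K)) ∧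
      -- its form in the range `1 ≤ λt ≤ √N / (2√2 e)`
      (1 ≤ QSwift.lam h * t →
        QSwift.lam h * t ≤ Real.sqrt N / (2 * Real.sqrt 2 * Real.exp 1) →
        QSwift.eta (QSwift.lam h * t) N ≤ 3 / 2 ∧
        QSwift.diamondDist (QSwift.idealU h H t) (QSwift.qswift h H t N K) ≤
          ENNReal.ofReal (3 / 2 * ((2 * Real.exp 1 * (QSwift.lam h * t)) ^ 2 / N) ^ K)) := by
  obtain ⟨k, rfl⟩ : ∃ k, K = k + 1 := ⟨K - 1, by omega⟩
  -- `8 e² x² / N = 2 r` for `r = (2 e x)² / N`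
  refine ⟨(k + 1) * (8 * Real.exp 1 ^ 2) ^ (k + 1), fun d L N h H t hh hH hn hKN => ?_⟩
  have hN : N ≠ 0 := by omega
  have small : 1 ≤ QSwift.lam h * t →
      (2 * Real.exp 1 * (QSwift.lam h * t)) ^ 2 / N ≤ 1 / 2 →
      QSwift.diamondDist (QSwift.idealU h H t) (QSwift.qswift h H t N (k + 1)) ≤
        ENNReal.ofReal (3 / 2 * ((2 * Real.exp 1 * (QSwift.lam h * t)) ^ 2 / N) ^ (k + 1)) := by
    intro hx hr
    refine (QSwift.diamondDist_le_eta hh hH hn (by linarith) hN (by linarith) k).trans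
      (ENNReal.ofReal_le_ofReal ?_)
    exact mul_le_mul_of_nonneg_right (QSwift.eta_le hx hr) (by positivity)
  refine ⟨fun hx => ?_, fun hx hr => QSwift.diamondDist_le_eta hh hH hn hx hN hr k,
    fun hx hx' => ?_⟩
  · have hC : (k + 1) * (8 * Real.exp 1 ^ 2) ^ (k + 1) *
        ((QSwift.lam h * t) ^ 2 / N) ^ (k + 1) =
        (k + 1) * (2 * ((2 * Real.exp 1 * (QSwift.lam h * t)) ^ 2 / N)) ^ (k + 1) := by
      rw [mul_assoc, ← mul_pow]
      ring
    rw [hC]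
    rcases le_total ((2 * Real.exp 1 * (QSwift.lam h * t)) ^ 2 / N) (1 / 2) with hr | hr
    · refine (small hx hr).trans (ENNReal.ofReal_le_ofReal ?_)
      have hr0 : 0 ≤ (2 * Real.exp 1 * (QSwift.lam h * t)) ^ 2 / N := by positivity
      rw [mul_pow (2 : ℝ) (_ / _), ← mul_assoc ((k : ℝ) + 1)]
      refine mul_le_mul_of_nonneg_right ?_ (pow_nonneg hr0 _)
      have h1 : (2 : ℝ) ≤ 2 ^ (k + 1) := by
        rw [pow_succ]
        linarith [one_le_pow₀ (show (1 : ℝ) ≤ 2 by norm_num) (n := k)]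
      nlinarith [(Nat.cast_nonneg k : (0 : ℝ) ≤ k)]
    · exact QSwift.diamondDist_le_of_half_le hh hH hn hx hN hr k
  · have hr : (2 * Real.exp 1 * (QSwift.lam h * t)) ^ 2 / N ≤ 1 / 2 := by
      have hN' : (0 : ℝ) < N := by exact_mod_cast Nat.pos_of_ne_zero hN
      rw [le_div_iff₀ (by positivity)] at hx'
      have h1 := pow_le_pow_left₀ (by positivity) hx' 2
      rw [Real.sq_sqrt hN'.le] at h1
      have h2 : Real.sqrt 2 ^ 2 = 2 := Real.sq_sqrt zero_le_two
      rw [div_le_iff₀ hN']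
      calc _ = (QSwift.lam h * t * (2 * Real.sqrt 2 * Real.exp 1)) ^ 2 / Real.sqrt 2 ^ 2 := by
            field_simp
        _ ≤ _ := by rw [h2]; linarith
    exact ⟨QSwift.eta_le hx hr, small hx hr⟩
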